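/- Let $d\ge 1$ be an integer, $c_0>0$ a real number, $A\in\mathbb R^{d\times d}$, and let $C\colon\mathbb R^d\to[0,\infty)$ be a spectral density (a nonnegative Lebesgue integrable function) with finite second moment, $\int |k|^2C_k\,dk<\infty$. Let $\eta\colon\mathbb R^d\to\mathbb R^d$, $k\mapsto\eta_k$, be square integrable with respect to the measure $C_k\,dk$. For a map $v\colon\mathbb R^d\to\mathbb R^d$ write $v\,\sharp\,C$ for the push-forward of the measure $C_k\,dk$ under $v$. For finite Borel measures $\mu,\nu$ on $\mathbb R^d$ of equal total mass and with finite second moments let $$W_2(\mu,\nu)=\Big(\inf_\pi\int |x-y|^2\,d\pi(x,y)\Big)^{1/2},$$ where $\pi$ ranges over the measures on $\mathbb R^d\times\mathbb R^d$ with marginals $\mu$ and $\nu$. A path $(\mu_c)_{c\in[0,c_0]}$ of such measures, all of the same total mass, is called an $L_2$-Wasserstein geodesic if $W_2(\mu_s,\mu_t)=\frac{|s-t|}{c_0}\,W_2(\mu_0,\mu_{c_0})$ for all $s,t\in[0,c_0]$. Suppose that both maps $k\mapsto k-c_0A^T\eta_k$ and $k\mapsto k+c_0A^T\eta_k$ are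 $C^1$ diffeomorphisms of $\mathbb R^d$ onto $\mathbb R^d$ and are gradients of convex functions $\mathbb R^d\to\mathbb R$. Then each of the two families $$\{(k-cA^T\eta_k)\,\sharp\,C : c\in[0,c_0]\}\qquad\text{and}\qquad\{(k+cA^T\eta_k)\,\sharp\,C : c\in[0,c_0]\}$$ consists of measures that are absolutely continuous with respect to Lebesgue measure, and each is an $L_2$-Wasserstein geodesic. -/

import Mathlib

open MeasureTheory Set
open scoped ENNReal Manifold ContDiff

/-- `π` is a coupling (transport plan) of `μ` and `ν`: its two marginals are `μ` and `ν`. -/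
def IsCoupling {E : Type*} [MeasurableSpace E] (π : Measure (E × E)) (μ ν : Measure E) : Prop :=
  π.map Prod.fst = μ ∧ π.map Prod.snd = ν

/-- The `L₂`-Wasserstein distance: the square root of the infimum of `∫ |x - y|² dπ(x, y)` over
all couplings `π` of `μ` and `ν`. The two measures need not be probability measures; the distance
is `∞` if their total masses differ, as there are no couplings then. -/
noncomputable def wassersteinTwo {E : Type*} [NormedAddCommGroup E] [MeasurableSpace E]
    (μ ν : Measure E) : ℝ≥0∞ :=
  (⨅ (π : Measure (E × E)) (_ : IsCoupling π μ ν), ∫⁻ p, edist p.1 p.2 ^ 2 ∂π) ^ (1 / 2 : ℝ)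

/-- The path `c ↦ μ c`, `c ∈ [0, c₀]`, is an `L₂`-Wasserstein geodesic: a minimising geodesic,
parametrised with constant speed, in the space of finite Borel measures of a fixed total mass with
finite second moment, equipped with the `L₂`-Wasserstein distance. -/
structure IsWassersteinTwoGeodesic {E : Type*} [NormedAddCommGroup E] [MeasurableSpace E]
    (c₀ : ℝ) (μ : ℝ → Measure E) : Prop where
  mass_ne_top : ∀ c ∈ Icc 0 c₀, μ c univ ≠ ⊤
  mass_eq : ∀ c ∈ Icc 0 c₀, μ c univ = μ 0 univ
  secondMoment_ne_top : ∀ c ∈ Icc 0 c₀, ∫⁻ k, ‖k‖ₑ ^ 2 ∂(μ c) ≠ ⊤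
  dist_eq : ∀ s ∈ Icc 0 c₀, ∀ t ∈ Icc 0 c₀,
    wassersteinTwo (μ s) (μ t) = ENNReal.ofReal (|s - t| / c₀) * wassersteinTwo (μ 0) (μ c₀)

/-- A spectral density with finite second moment: a nonnegative Lebesgue integrable function `C`
with `∫ |k|² C(k) dk < ∞`. -/
structure IsSpectralDensity {d : ℕ} (C : EuclideanSpace ℝ (Fin d) → ℝ) : Prop where
  nonneg : ∀ k, 0 ≤ C k
  integrable : Integrable C
  integrable_secondMoment : Integrable fun k => ‖k‖ ^ 2 * C k

/-- The spectral measure `C(k) dk`. -/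
noncomputable def spectralMeasure {d : ℕ} (C : EuclideanSpace ℝ (Fin d) → ℝ) :
    Measure (EuclideanSpace ℝ (Fin d)) :=
  volume.withDensity fun k => ENNReal.ofReal (C k)

/-- The map `k ↦ k + c Aᵀ η(k)`. -/
noncomputable def spectralShift {d : ℕ} (A : Matrix (Fin d) (Fin d) ℝ)
    (η : EuclideanSpace ℝ (Fin d) → EuclideanSpace ℝ (Fin d)) (c : ℝ)
    (k : EuclideanSpace ℝ (Fin d)) : EuclideanSpace ℝ (Fin d) :=
  k + c • Matrix.toEuclideanCLM (𝕜 := ℝ) A.transpose (η k)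

/-- `T` is a `C¹` diffeomorphism of `E` onto itself. -/
def IsC1Diffeo {E : Type*} [NormedAddCommGroup E] [NormedSpace ℝ E] (T : E → E) : Prop :=
  ∃ e : Diffeomorph 𝓘(ℝ, E) 𝓘(ℝ, E) E E 1, ⇑e = T

/-- `T` is the gradient of a (finite, everywhere differentiable) convex function on `E`. -/
def IsGradientOfConvex {E : Type*} [NormedAddCommGroup E] [InnerProductSpace ℝ E]
    [CompleteSpace E] (T : E → E) : Prop :=
  ∃ φ : E → ℝ, ConvexOn ℝ univ φ ∧ ∀ k, HasGradientAt φ (T k) k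

/-!
With `M = Aᵀ η`, the two families are the displacement interpolations `c ↦ (id + c M) ♯ C` and
`c ↦ (id - c M) ♯ C`, and each is treated separately, using only the assumption on its own endpoint
map (`isWassersteinTwoGeodesic_displacement`).

If `id + c₀ M = ∇φ` with `φ` convex, then `ψ = (φ - ‖·‖² / 2) / c₀` is a potential for `M` whose
negative curvature is at most `1 / c₀` (`HasSemiconvexPotential`). Two consequences are used.

* For `0 ≤ s < c₀` the map `id + s M` is strongly monotone, hence injective with Lipschitz inverse
  (`HasSemiconvexPotential.antilipschitzWith`), so preimages of Lebesgue null sets are null. At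
  `s = c₀` the inverse is `C¹`, with the same effect. This gives absolute continuity.

* Transporting `ψ` along `k ↦ k + s M k` solves the Hamilton–Jacobi equation: the value at
  `k + s M k` is `ψ k + s / 2 * ‖M k‖ ^ 2`. The Hopf–Lax formula says that this function grows
  between two points in space-time by at most `‖x - y‖² / (2 (t - s))`
  (`HasSemiconvexPotential.sub_le_norm_sub_sq`). Integrating this against an arbitrary plan between
  the measures at times `s` and `t` bounds its cost below by `(t - s)² ∫ ‖M‖²`, the cost of the plan
  `(id + s M, id + t M) ♯ C`. So `W₂` between times `s` and `t` equals
  `|s - t| (∫ ‖M‖²) ^ (1 / 2)` directly, and no triangle inequality for `W₂` is required.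
-/

/-! ### Preliminaries -/

/-- A convex function lies above its tangent hyperplanes. -/
theorem ConvexOn.add_inner_gradient_le {E : Type*} [NormedAddCommGroup E] [InnerProductSpace ℝ E]
    [CompleteSpace E] {φ : E → ℝ} (hφ : ConvexOn ℝ univ φ) {g l : E} (hg : HasGradientAt φ g l)
    (k : E) : φ l + inner ℝ g (k - l) ≤ φ k := by
  have hline : HasDerivAt (fun r : ℝ => φ (AffineMap.lineMap l k r)) (inner ℝ g (k - l)) 0 := by
    have h := hg.hasFDerivAt
    rw [← AffineMap.lineMap_apply_zero (k := ℝ) l k] at h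
    simpa [Function.comp_def] using h.comp_hasDerivAt (0 : ℝ)
      (AffineMap.hasDerivAt_lineMap (a := l) (b := k) (x := (0 : ℝ)))
  have hconv : ConvexOn ℝ univ (fun r : ℝ => φ (AffineMap.lineMap l k r)) := by
    simpa [Function.comp_def] using hφ.comp_affineMap (AffineMap.lineMap l k : ℝ →ᵃ[ℝ] E)
  have h := hconv.le_slope_of_hasDerivAt (mem_univ 0) (mem_univ 1) one_pos hline
  simp [slope_def_field] at h
  linarith

theorem wassersteinTwo_comm {E : Type*} [NormedAddCommGroup E] [MeasurableSpace E]
    (μ ν : Measure E) : wassersteinTwo μ ν = wassersteinTwo ν μ := by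
  have key : ∀ μ ν : Measure E,
      (⨅ (π : Measure (E × E)) (_ : IsCoupling π μ ν), ∫⁻ p, edist p.1 p.2 ^ 2 ∂π) ≤
        ⨅ (π : Measure (E × E)) (_ : IsCoupling π ν μ), ∫⁻ p, edist p.1 p.2 ^ 2 ∂π := by
    intro μ ν
    refine le_iInf₂ fun π hπ => iInf₂_le_of_le (π.map Prod.swap) ⟨?_, ?_⟩ ?_
    · rw [Measure.map_map measurable_fst measurable_swap]
      exact hπ.2
    · rw [Measure.map_map measurable_snd measurable_swap]
      exact hπ.1
    · rw [show (Prod.swap : E × E → E × E) = MeasurableEquiv.prodComm from rfl,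
        lintegral_map_equiv]
      exact (lintegral_congr fun p => by rw [edist_comm]; rfl).le
  rw [wassersteinTwo, wassersteinTwo, le_antisymm (key μ ν) (key ν μ)]

/-- Unlike `ofReal_integral_eq_lintegral_ofReal`, this needs no sign condition on `f` and no
measurability of `g`. -/
theorem ofReal_integral_le_lintegral {α : Type*} [MeasurableSpace α] {π : Measure α} {f : α → ℝ}
    {g : α → ℝ≥0∞} (hf : Integrable f π) (hfg : ∀ᵐ x ∂π, ENNReal.ofReal (f x) ≤ g x) :
    ENNReal.ofReal (∫ x, f x ∂π) ≤ ∫⁻ x, g x ∂π := by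
  calc ENNReal.ofReal (∫ x, f x ∂π)
      ≤ ENNReal.ofReal (∫ x, max (f x) 0 ∂π) := by
        exact ENNReal.ofReal_le_ofReal (integral_mono hf hf.pos_part fun x => le_max_left _ _)
    _ = ∫⁻ x, ENNReal.ofReal (max (f x) 0) ∂π :=
        ofReal_integral_eq_lintegral_ofReal hf.pos_part (.of_forall fun x => le_max_right _ _)
    _ ≤ ∫⁻ x, g x ∂π := by
        refine lintegral_mono_ae (hfg.mono fun x hx => ?_)
        simpa [ENNReal.ofReal_max] using hx

/-! ### Semiconvex potentials -/

/-- `M` is a gradient field of `ψ`, in the sense that `ψ + ‖·‖² / (2 c₀)` is convex with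
subgradient `M + id / c₀`. The inequality is the subgradient inequality after the quadratic terms
have been collected. -/
def HasSemiconvexPotential {E : Type*} [NormedAddCommGroup E] [InnerProductSpace ℝ E] (c₀ : ℝ)
    (ψ : E → ℝ) (M : E → E) : Prop :=
  ∀ k l, ψ l + inner ℝ (M l) (k - l) - ‖k - l‖ ^ 2 / (2 * c₀) ≤ ψ k

section Potential

variable {E : Type*} [NormedAddCommGroup E] [InnerProductSpace ℝ E] {c₀ : ℝ} {ψ : E → ℝ}
  {M : E → E}

/-- If `id + c₀ M` is the gradient of a convex function `φ`, then `M` has the semiconvex potential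
`(φ - ‖·‖² / 2) / c₀`. -/
theorem IsGradientOfConvex.exists_hasSemiconvexPotential [CompleteSpace E] (hc₀ : 0 < c₀)
    (h : IsGradientOfConvex fun k => k + c₀ • M k) :
    ∃ ψ : E → ℝ, Continuous ψ ∧ HasSemiconvexPotential c₀ ψ M := by
  obtain ⟨φ, hφ, hg⟩ := h
  have hcont : Continuous φ := continuous_iff_continuousAt.2 fun k => (hg k).continuousAt
  refine ⟨fun k => (φ k - ‖k‖ ^ 2 / 2) / c₀, by fun_prop, fun k l => ?_⟩
  have h1 := hφ.add_inner_gradient_le (hg l) k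
  have h2 := norm_sub_sq_real k l
  have h3 : inner ℝ (l + c₀ • M l) (k - l)
      = inner ℝ k l - ‖l‖ ^ 2 + c₀ * inner ℝ (M l) (k - l) := by
    rw [inner_add_left, real_inner_smul_left, inner_sub_right l k l, real_inner_self_eq_norm_sq,
      real_inner_comm]
  rw [le_div_iff₀ hc₀]
  have h4 : ((φ l - ‖l‖ ^ 2 / 2) / c₀ + inner ℝ (M l) (k - l) - ‖k - l‖ ^ 2 / (2 * c₀)) * c₀
      = φ l - ‖l‖ ^ 2 / 2 + c₀ * inner ℝ (M l) (k - l) - ‖k - l‖ ^ 2 / 2 := by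
    field_simp
  linarith

namespace HasSemiconvexPotential

/-- Before time `c₀` the displacement maps are uniformly monotone, so they do not contract
distances by more than the factor `1 - s / c₀`. -/
theorem antilipschitzWith (h : HasSemiconvexPotential c₀ ψ M) {s : ℝ} (hs : 0 ≤ s)
    (hsc : s < c₀) :
    AntilipschitzWith (Real.toNNReal (1 - s / c₀)⁻¹) fun k => k + s • M k := by
  have hc₀ : 0 < c₀ := hs.trans_lt hsc
  have hr : 0 < 1 - s / c₀ := by rw [sub_pos, div_lt_one hc₀]; exact hsc
  refine AntilipschitzWith.of_le_mul_dist fun k l => ?_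
  rw [Real.coe_toNNReal _ (inv_nonneg.2 hr.le), inv_mul_eq_div, le_div_iff₀ hr, dist_eq_norm,
    dist_eq_norm]
  have h1 := h k l
  have h2 := h l k
  rw [norm_sub_rev l k, ← neg_sub k l, inner_neg_right] at h2
  have h3 : -(‖k - l‖ ^ 2 / c₀) ≤ inner ℝ (M k - M l) (k - l) := by
    rw [inner_sub_left]
    have : ‖k - l‖ ^ 2 / c₀ = 2 * (‖k - l‖ ^ 2 / (2 * c₀)) := by field_simp
    linarith
  have h4 : inner ℝ ((k + s • M k) - (l + s • M l)) (k - l)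
      = ‖k - l‖ ^ 2 + s * inner ℝ (M k - M l) (k - l) := by
    rw [show (k + s • M k) - (l + s • M l) = (k - l) + s • (M k - M l) by module,
      inner_add_left, real_inner_smul_left, real_inner_self_eq_norm_sq]
  have h5 := real_inner_le_norm ((k + s • M k) - (l + s • M l)) (k - l)
  have h6 := mul_le_mul_of_nonneg_left h3 hs
  rcases (norm_nonneg (k - l)).eq_or_lt with h0 | h0
  · rw [← h0]; simp
  · refine le_of_mul_le_mul_right ?_ h0
    calc ‖k - l‖ * (1 - s / c₀) * ‖k - l‖ = ‖k - l‖ ^ 2 + s * -(‖k - l‖ ^ 2 / c₀) := by ring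
      _ ≤ _ := by linarith

/-- The Hamilton–Jacobi inequality along displacement interpolation. Transporting `ψ` along the
maps `k ↦ k + s M k` gives the Hopf–Lax solution with value `ψ k + s / 2 * ‖M k‖ ^ 2` at
`k + s M k`; its growth between two times is bounded by the transport cost. -/
theorem sub_le_norm_sub_sq (h : HasSemiconvexPotential c₀ ψ M) {s t : ℝ} (hs : 0 ≤ s)
    (hst : s < t) (htc : t ≤ c₀) (k l : E) :
    2 * (t - s) * ((ψ l + t / 2 * ‖M l‖ ^ 2) - (ψ k + s / 2 * ‖M k‖ ^ 2))
      ≤ ‖(k + s • M k) - (l + t • M l)‖ ^ 2 := by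
  have ht : 0 < t := hs.trans_lt hst
  have h1 : ψ l - ψ k ≤ ‖k - l‖ ^ 2 / (2 * t) - inner ℝ (M l) (k - l) := by
    have := h k l
    have : ‖k - l‖ ^ 2 / (2 * c₀) ≤ ‖k - l‖ ^ 2 / (2 * t) := by gcongr
    linarith
  -- With `u = k - l - t M l` the difference of the two sides is at least `s / t * ‖u + t M k‖ ^ 2`.
  set u := k - l - t • M l with hu
  have h2 : ‖u‖ ^ 2 = ‖k - l‖ ^ 2 - 2 * t * inner ℝ (M l) (k - l) + t ^ 2 * ‖M l‖ ^ 2 := by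
    rw [hu, norm_sub_sq_real, real_inner_smul_right, norm_smul, mul_pow, Real.norm_eq_abs, sq_abs,
      real_inner_comm]
    ring
  have h3 : ∀ r : ℝ, ‖u + r • M k‖ ^ 2 = ‖u‖ ^ 2 + 2 * r * inner ℝ u (M k) + r ^ 2 * ‖M k‖ ^ 2 := by
    intro r
    rw [norm_add_sq_real, real_inner_smul_right, norm_smul, mul_pow, Real.norm_eq_abs, sq_abs]
    ring
  have h4 : 0 ≤ s / t * ‖u + t • M k‖ ^ 2 := by positivity
  rw [show (k + s • M k) - (l + t • M l) = u + s • M k by rw [hu]; module, h3]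
  rw [h3] at h4
  have h5 : 2 * (t - s) * (ψ l - ψ k)
      ≤ 2 * (t - s) * (‖k - l‖ ^ 2 / (2 * t) - inner ℝ (M l) (k - l)) :=
    mul_le_mul_of_nonneg_left h1 (by linarith)
  have h6 : 2 * (t - s) * (‖k - l‖ ^ 2 / (2 * t) - inner ℝ (M l) (k - l))
      = (t - s) * (‖u‖ ^ 2 / t - t * ‖M l‖ ^ 2) := by
    rw [h2]; field_simp; ring
  have h7 : s / t * (‖u‖ ^ 2 + 2 * t * inner ℝ u (M k) + t ^ 2 * ‖M k‖ ^ 2)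
      = s * (‖u‖ ^ 2 / t) + 2 * s * inner ℝ u (M k) + s * t * ‖M k‖ ^ 2 := by
    field_simp
  have h8 : ‖u‖ ^ 2 = t * (‖u‖ ^ 2 / t) := by field_simp
  rw [h7] at h4
  rw [h6] at h5
  linarith

/-- Comparing with the origin bounds a semiconvex potential below by a quadratic polynomial, and
above by `⟪M l, l⟫` plus a quadratic polynomial; all of these are integrable. -/
theorem integrable [MeasurableSpace E] [BorelSpace E] [SecondCountableTopology E]
    (h : HasSemiconvexPotential c₀ ψ M) (hψ : Continuous ψ)
    {μ : Measure E} [IsFiniteMeasure μ] (hid : MemLp (fun k : E => k) 2 μ) (hM : MemLp M 2 μ) :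
    Integrable ψ μ := by
  have hsq : Integrable (fun k : E => ‖k‖ ^ 2) μ := hid.integrable_norm_pow (by norm_num)
  have hlow : Integrable (fun k : E => ψ 0 + inner ℝ (M 0) k - ‖k‖ ^ 2 / (2 * c₀)) μ :=
    ((integrable_const _).add ((hid.integrable one_le_two).const_inner _)).sub (hsq.div_const _)
  have hin : Integrable (fun l : E => inner ℝ (M l) l) μ :=
    (hM.norm.integrable_mul hid.norm).mono
      (hM.aestronglyMeasurable.inner hid.aestronglyMeasurable)
      (.of_forall fun l => by simpa using norm_inner_le_norm (𝕜 := ℝ) (M l) l)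
  have hup : Integrable (fun l : E => ψ 0 + inner ℝ (M l) l + ‖l‖ ^ 2 / (2 * c₀)) μ :=
    ((integrable_const _).add hin).add (hsq.div_const _)
  refine integrable_of_le_of_le hψ.aestronglyMeasurable (.of_forall fun k => ?_)
    (.of_forall fun l => ?_) hlow hup
  · simpa using h k 0
  · have := h 0 l
    simp only [zero_sub, inner_neg_right, norm_neg] at this
    linarith

end HasSemiconvexPotential

end Potential

/-! ### Optimality of displacement interpolation -/

section Transport

variable {E : Type*} [NormedAddCommGroup E] [InnerProductSpace ℝ E] [MeasurableSpace E]
  [BorelSpace E] [SecondCountableTopology E] {c₀ : ℝ} {ψ : E → ℝ} {M : E → E} {μ : Measure E}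

/-- The plan carried by a pair of displacement maps bounds the Wasserstein distance. -/
theorem wassersteinTwo_displacement_le (hM : Measurable M) (s t : ℝ) :
    wassersteinTwo (μ.map fun k => k + s • M k) (μ.map fun k => k + t • M k)
      ≤ (ENNReal.ofReal ((t - s) ^ 2) * ∫⁻ k, ‖M k‖ₑ ^ 2 ∂μ) ^ (1 / 2 : ℝ) := by
  have hT : ∀ r : ℝ, Measurable fun k => k + r • M k := fun r => by fun_prop
  refine ENNReal.rpow_le_rpow ?_ (by norm_num)
  refine iInf₂_le_of_le (μ.map fun k => (k + s • M k, k + t • M k)) ⟨?_, ?_⟩ ?_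
  · rw [Measure.map_map measurable_fst ((hT s).prodMk (hT t))]; rfl
  · rw [Measure.map_map measurable_snd ((hT s).prodMk (hT t))]; rfl
  · rw [lintegral_map (by fun_prop) ((hT s).prodMk (hT t)),
      ← lintegral_const_mul _ (by fun_prop)]
    refine (lintegral_congr fun k => ?_).le
    rw [edist_eq_enorm_sub, show (k + s • M k) - (k + t • M k) = (s - t) • M k by module,
      enorm_smul, mul_pow, ← enorm_pow, Real.enorm_of_nonneg (sq_nonneg _)]
    congr 2
    ring

/-- Every plan between two displaced measures costs at least as much as the plan carried by the
displacement maps. The maps are inverted almost everywhere, and the Hamilton–Jacobi inequality is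
integrated against the plan; each of its two potential terms depends on one marginal only. -/
theorem HasSemiconvexPotential.le_lintegral_edist_sq [IsFiniteMeasure μ] [CompleteSpace E]
    (h : HasSemiconvexPotential c₀ ψ M)
    (hψ : Continuous ψ) (hMc : Continuous M) (hid : MemLp (fun k : E => k) 2 μ) (hM : MemLp M 2 μ)
    {s t : ℝ} (hs : 0 ≤ s) (hst : s < t) (htc : t ≤ c₀)
    (hinj_s : Function.Injective fun k => k + s • M k)
    (hinj_t : Function.Injective fun k => k + t • M k) {π : Measure (E × E)}
    (hπ : IsCoupling π (μ.map fun k => k + s • M k) (μ.map fun k => k + t • M k)) :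
    ENNReal.ofReal ((t - s) ^ 2) * ∫⁻ k, ‖M k‖ₑ ^ 2 ∂μ ≤ ∫⁻ p, edist p.1 p.2 ^ 2 ∂π := by
  have hT : ∀ r : ℝ, Measurable fun k => k + r • M k := fun r => by fun_prop
  -- By the Lusin–Souslin theorem the injective displacement maps have measurable left inverses.
  have hinv : ∀ r : ℝ, Function.Injective (fun k => k + r • M k) →
      ∃ g : E → E, Measurable g ∧ ∀ k, g (k + r • M k) = k := fun r hr => by
    obtain ⟨g, hg, hgT⟩ := ((hT r).measurableEmbedding hr).exists_measurable_extend
      measurable_id fun k => ⟨k⟩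
    exact ⟨g, hg, fun k => congrFun hgT k⟩
  obtain ⟨f, hf, hfT⟩ := hinv s hinj_s
  obtain ⟨g, hg, hgT⟩ := hinv t hinj_t
  have hψi := h.integrable hψ hid hM
  have hsq : Integrable (fun k => ‖M k‖ ^ 2) μ := hM.integrable_norm_pow (by norm_num)
  let G : ℝ → E → ℝ := fun r k => ψ k + r / 2 * ‖M k‖ ^ 2
  have hGi : ∀ r, Integrable (G r) μ := fun r => hψi.add (hsq.const_mul _)
  -- The marginals of `π`, pulled back by the left inverses, are both `μ`.
  have hmap_f : MeasurePreserving (fun p : E × E => f p.1) π μ := by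
    refine ⟨by fun_prop, ?_⟩
    rw [← Function.comp_def, ← Measure.map_map hf measurable_fst, hπ.1,
      Measure.map_map hf (hT s), show f ∘ (fun k => k + s • M k) = id from funext hfT,
      Measure.map_id]
  have hmap_g : MeasurePreserving (fun p : E × E => g p.2) π μ := by
    refine ⟨by fun_prop, ?_⟩
    rw [← Function.comp_def, ← Measure.map_map hg measurable_snd, hπ.2,
      Measure.map_map hg (hT t), show g ∘ (fun k => k + t • M k) = id from funext hgT,
      Measure.map_id]
  have hae_f : ∀ᵐ p ∂π, f p.1 + s • M (f p.1) = p.1 := by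
    have : ∀ᵐ x ∂(π.map Prod.fst), f x + s • M (f x) = x := by
      rw [hπ.1, ae_map_iff (hT s).aemeasurable (measurableSet_eq_fun (by fun_prop) (by fun_prop))]
      exact .of_forall fun k => by rw [hfT]
    exact ae_of_ae_map measurable_fst.aemeasurable this
  have hae_g : ∀ᵐ p ∂π, g p.2 + t • M (g p.2) = p.2 := by
    have : ∀ᵐ x ∂(π.map Prod.snd), g x + t • M (g x) = x := by
      rw [hπ.2, ae_map_iff (hT t).aemeasurable (measurableSet_eq_fun (by fun_prop) (by fun_prop))]
      exact .of_forall fun k => by rw [hgT]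
    exact ae_of_ae_map measurable_snd.aemeasurable this
  have hi_f : Integrable (fun p : E × E => G s (f p.1)) π :=
    hmap_f.integrable_comp_of_integrable (hGi s)
  have hi_g : Integrable (fun p : E × E => G t (g p.2)) π :=
    hmap_g.integrable_comp_of_integrable (hGi t)
  have hint : ∫ p, 2 * (t - s) * (G t (g p.2) - G s (f p.1)) ∂π
      = (t - s) ^ 2 * ∫ k, ‖M k‖ ^ 2 ∂μ := by
    have e_f : ∫ p, G s (f p.1) ∂π = ∫ k, G s k ∂μ := by
      rw [← hmap_f.map_eq, integral_map hmap_f.aemeasurable]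
      rw [hmap_f.map_eq]
      exact (hGi s).aestronglyMeasurable
    have e_g : ∫ p, G t (g p.2) ∂π = ∫ k, G t k ∂μ := by
      rw [← hmap_g.map_eq, integral_map hmap_g.aemeasurable]
      rw [hmap_g.map_eq]
      exact (hGi t).aestronglyMeasurable
    have e : ∀ r, ∫ k, G r k ∂μ = ∫ k, ψ k ∂μ + r / 2 * ∫ k, ‖M k‖ ^ 2 ∂μ := fun r => by
      rw [integral_add hψi (hsq.const_mul _), integral_const_mul]
    rw [integral_const_mul, integral_sub hi_g hi_f, e_f, e_g, e, e]
    ring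
  have hcost : ∫⁻ k, ‖M k‖ₑ ^ 2 ∂μ = ENNReal.ofReal (∫ k, ‖M k‖ ^ 2 ∂μ) := by
    rw [ofReal_integral_eq_lintegral_ofReal hsq (.of_forall fun k => sq_nonneg _)]
    exact lintegral_congr fun k => by rw [ENNReal.ofReal_pow (norm_nonneg _), ofReal_norm]
  rw [hcost, ← ENNReal.ofReal_mul (sq_nonneg _), ← hint]
  refine ofReal_integral_le_lintegral ((hi_g.sub hi_f).const_mul _) ?_
  filter_upwards [hae_f, hae_g] with p hp₁ hp₂
  have := h.sub_le_norm_sub_sq hs hst htc (f p.1) (g p.2)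
  rw [hp₁, hp₂] at this
  rw [edist_eq_enorm_sub, ← ofReal_norm, ← ENNReal.ofReal_pow (norm_nonneg _)]
  exact ENNReal.ofReal_le_ofReal this

/-- The displacement plan is optimal between any two times in `[0, c₀]`. -/
theorem HasSemiconvexPotential.wassersteinTwo_displacement [IsFiniteMeasure μ] [CompleteSpace E]
    (h : HasSemiconvexPotential c₀ ψ M)
    (hψ : Continuous ψ) (hMc : Continuous M) (hid : MemLp (fun k : E => k) 2 μ) (hM : MemLp M 2 μ)
    (hinj : ∀ s ∈ Icc 0 c₀, Function.Injective fun k => k + s • M k)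
    {s t : ℝ} (hs : s ∈ Icc 0 c₀) (ht : t ∈ Icc 0 c₀) :
    wassersteinTwo (μ.map fun k => k + s • M k) (μ.map fun k => k + t • M k)
      = ENNReal.ofReal |s - t| * (∫⁻ k, ‖M k‖ₑ ^ 2 ∂μ) ^ (1 / 2 : ℝ) := by
  wlog hst : s ≤ t generalizing s t
  · rw [wassersteinTwo_comm, abs_sub_comm]
    exact this ht hs (le_of_not_ge hst)
  have hpow : ENNReal.ofReal |s - t| * (∫⁻ k, ‖M k‖ₑ ^ 2 ∂μ) ^ (1 / 2 : ℝ)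
      = (ENNReal.ofReal ((t - s) ^ 2) * ∫⁻ k, ‖M k‖ₑ ^ 2 ∂μ) ^ (1 / 2 : ℝ) := by
    rw [ENNReal.mul_rpow_of_nonneg _ _ (by norm_num),
      ENNReal.ofReal_rpow_of_nonneg (sq_nonneg _) (by norm_num), ← Real.sqrt_eq_rpow,
      Real.sqrt_sq_eq_abs, abs_sub_comm]
  rw [hpow]
  refine le_antisymm (wassersteinTwo_displacement_le hMc.measurable s t) ?_
  rcases hst.eq_or_lt with rfl | hlt
  · simp
  · exact ENNReal.rpow_le_rpow (le_iInf₂ fun π hπ =>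
      h.le_lintegral_edist_sq hψ hMc hid hM hs.1 hlt ht.2 (hinj s hs) (hinj t ht) hπ)
      (by norm_num)

end Transport

/-! ### Absolute continuity -/

section AbsolutelyContinuous

variable {E : Type*} [NormedAddCommGroup E] [InnerProductSpace ℝ E] [FiniteDimensional ℝ E]
  [MeasurableSpace E] [BorelSpace E]

/-- Preimages of null sets under an antilipschitz map are null, because Lebesgue measure is
comparable with the Hausdorff measure of the same dimension. -/
theorem AntilipschitzWith.quasiMeasurePreserving_volume {K : NNReal} {T : E → E}
    (h : AntilipschitzWith K T) (hT : Measurable T) :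
    Measure.QuasiMeasurePreserving T (volume : Measure E) volume := by
  refine ⟨hT, .mk fun N hN hN0 => ?_⟩
  rw [Measure.map_apply hT hN]
  let H : Measure E := Measure.hausdorffMeasure (Module.finrank ℝ E)
  have h1 : (volume : Measure E) ≪ H := Measure.absolutelyContinuous_isAddHaarMeasure _ _
  have h2 : H ≪ (volume : Measure E) := Measure.absolutelyContinuous_isAddHaarMeasure _ _
  refine h1 (le_antisymm ?_ zero_le)
  calc H (T ⁻¹' N) ≤ (K : ℝ≥0∞) ^ (Module.finrank ℝ E : ℝ) * H N :=
        h.hausdorffMeasure_preimage_le (Nat.cast_nonneg _) N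
    _ = 0 := by rw [h2 hN0, mul_zero]

theorem IsC1Diffeo.quasiMeasurePreserving_volume {T : E → E} (h : IsC1Diffeo T) :
    Measure.QuasiMeasurePreserving T (volume : Measure E) volume := by
  obtain ⟨e, rfl⟩ := h
  refine ⟨e.continuous.measurable, .mk fun N hN hN0 => ?_⟩
  rw [Measure.map_apply e.continuous.measurable hN]
  have : e ⁻¹' N = e.symm '' N := (e.toEquiv.symm.image_eq_preimage_symm N).symm
  rw [this]
  exact addHaar_image_eq_zero_of_differentiableOn_of_addHaar_eq_zero volume
    (e.symm.contMDiff.contDiff.differentiable one_ne_zero).differentiableOn hN0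

end AbsolutelyContinuous

/-! ### Geodesics -/

/-- For a displacement field `M` such that `id + c₀ M` is a `C¹` diffeomorphism and the gradient of a
convex function, the displacement interpolation `c ↦ (id + c M) ♯ μ` stays absolutely continuous and
is a geodesic. For `c < c₀` absolute continuity comes from monotonicity alone; the diffeomorphism
property is needed for it at `c = c₀`. -/
theorem isWassersteinTwoGeodesic_displacement {E : Type*} [NormedAddCommGroup E]
    [InnerProductSpace ℝ E] [FiniteDimensional ℝ E] [CompleteSpace E] [MeasurableSpace E]
    [BorelSpace E] {c₀ : ℝ} (hc₀ : 0 < c₀) {μ : Measure E} [IsFiniteMeasure μ] {M : E → E}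
    (hμ : μ ≪ volume) (hid : MemLp (fun k : E => k) 2 μ) (hM : MemLp M 2 μ)
    (hdiff : IsC1Diffeo fun k => k + c₀ • M k)
    (hgrad : IsGradientOfConvex fun k => k + c₀ • M k) :
    (∀ c ∈ Icc 0 c₀, μ.map (fun k => k + c • M k) ≪ volume) ∧
      IsWassersteinTwoGeodesic c₀ fun c => μ.map fun k => k + c • M k := by
  obtain ⟨ψ, hψ, h⟩ := hgrad.exists_hasSemiconvexPotential hc₀
  have hTc : Continuous fun k => k + c₀ • M k := by
    obtain ⟨e, he⟩ := hdiff
    exact he ▸ e.continuous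
  have hMc : Continuous M := by
    have : M = fun k => c₀⁻¹ • ((k + c₀ • M k) - k) := by
      ext1 k
      rw [add_sub_cancel_left, inv_smul_smul₀ hc₀.ne']
    rw [this]
    exact (hTc.sub continuous_id).const_smul _
  have hT : ∀ c : ℝ, Measurable fun k => k + c • M k := fun c => by fun_prop
  have hinj : ∀ c ∈ Icc 0 c₀, Function.Injective fun k => k + c • M k := fun c hc => by
    rcases hc.2.eq_or_lt with rfl | hlt
    · obtain ⟨e, he⟩ := hdiff
      exact he ▸ e.injective
    · exact (h.antilipschitzWith hc.1 hlt).injective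
  refine ⟨fun c hc => ?_, fun c _ => ?_, fun c _ => ?_, fun c _ => ?_, fun s hs t ht => ?_⟩
  · have hq : Measure.QuasiMeasurePreserving (fun k => k + c • M k) (volume : Measure E)
        volume := by
      rcases hc.2.eq_or_lt with rfl | hlt
      · exact hdiff.quasiMeasurePreserving_volume
      · exact (h.antilipschitzWith hc.1 hlt).quasiMeasurePreserving_volume (hT c)
    exact (hμ.map (hT c)).trans hq.absolutelyContinuous
  · exact measure_ne_top _ _
  · rw [Measure.map_apply (hT c) .univ, Measure.map_apply (hT 0) .univ, preimage_univ,
      preimage_univ]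
  · rw [lintegral_map (by fun_prop) (hT c)]
    have h2 : MemLp (fun k => k + c • M k) 2 μ := hid.add (hM.const_smul c)
    have h3 := h2.2
    rw [eLpNorm_lt_top_iff_lintegral_rpow_enorm_lt_top two_ne_zero ENNReal.ofNat_ne_top] at h3
    simpa using h3.ne
  · have hdist := fun {s t : ℝ} =>
      h.wassersteinTwo_displacement (s := s) (t := t) hψ hMc hid hM hinj
    rw [hdist hs ht, hdist (left_mem_Icc.2 hc₀.le) (right_mem_Icc.2 hc₀.le), ← mul_assoc,
      ← ENNReal.ofReal_mul (by positivity), zero_sub, abs_neg, abs_of_pos hc₀,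
      div_mul_cancel₀ _ hc₀.ne']

theorem spectralMeasure_absolutelyContinuous {d : ℕ} (C : EuclideanSpace ℝ (Fin d) → ℝ) :
    spectralMeasure C ≪ volume :=
  withDensity_absolutelyContinuous _ _

theorem IsSpectralDensity.isFiniteMeasure_spectralMeasure {d : ℕ}
    {C : EuclideanSpace ℝ (Fin d) → ℝ} (hC : IsSpectralDensity C) :
    IsFiniteMeasure (spectralMeasure C) :=
  isFiniteMeasure_withDensity_ofReal hC.integrable.2

theorem IsSpectralDensity.memLp_id {d : ℕ} {C : EuclideanSpace ℝ (Fin d) → ℝ}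
    (hC : IsSpectralDensity C) :
    MemLp (fun k : EuclideanSpace ℝ (Fin d) => k) 2 (spectralMeasure C) := by
  rw [memLp_two_iff_integrable_sq_norm (by fun_prop), spectralMeasure,
    integrable_withDensity_iff_integrable_smul₀'
      hC.integrable.aestronglyMeasurable.aemeasurable.ennreal_ofReal
      (.of_forall fun _ => ENNReal.ofReal_lt_top)]
  refine hC.integrable_secondMoment.congr (.of_forall fun k => ?_)
  simp only [ENNReal.toReal_ofReal (hC.nonneg k), smul_eq_mul, mul_comm]

theorem mainTheorem7 (d : ℕ) (hd : 1 ≤ d) (c₀ : ℝ) (hc₀ : 0 < c₀)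
    (A : Matrix (Fin d) (Fin d) ℝ)
    (C : EuclideanSpace ℝ (Fin d) → ℝ) (hC : IsSpectralDensity C)
    (η : EuclideanSpace ℝ (Fin d) → EuclideanSpace ℝ (Fin d))
    (hη : MemLp η 2 (spectralMeasure C))
    (hdiff_neg : IsC1Diffeo (spectralShift A η (-c₀)))
    (hgrad_neg : IsGradientOfConvex (spectralShift A η (-c₀)))
    (hdiff_pos : IsC1Diffeo (spectralShift A η c₀))
    (hgrad_pos : IsGradientOfConvex (spectralShift A η c₀)) :
    ((∀ c ∈ Icc 0 c₀, (spectralMeasure C).map (spectralShift A η (-c)) ≪ volume) ∧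
      IsWassersteinTwoGeodesic c₀ fun c => (spectralMeasure C).map (spectralShift A η (-c))) ∧
    ((∀ c ∈ Icc 0 c₀, (spectralMeasure C).map (spectralShift A η c) ≪ volume) ∧
      IsWassersteinTwoGeodesic c₀ fun c => (spectralMeasure C).map (spectralShift A η c)) := by
  have := hC.isFiniteMeasure_spectralMeasure
  have hM := (Matrix.toEuclideanCLM (𝕜 := ℝ) A.transpose).comp_memLp' hη
  -- The first family is the second one for the displacement field `-Aᵀ η`.
  have hneg : ∀ c : ℝ, spectralShift A η (-c)
      = fun k => k + c • -Matrix.toEuclideanCLM (𝕜 := ℝ) A.transpose (η k) := fun c => by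
    ext1 k
    rw [spectralShift, smul_neg, neg_smul]
  simp only [hneg] at hdiff_neg hgrad_neg ⊢
  exact ⟨isWassersteinTwoGeodesic_displacement hc₀ (spectralMeasure_absolutelyContinuous C)
      hC.memLp_id hM.neg hdiff_neg hgrad_neg,
    isWassersteinTwoGeodesic_displacement hc₀ (spectralMeasure_absolutelyContinuous C)
      hC.memLp_id hM hdiff_pos hgrad_pos⟩
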